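/- Let $K$ be a field, let $m,k\ge 0$, let $A=K[a_1,\dots,a_m]$, and let $P=A[x_1,\dots,x_k]$ be $\mathbb{Z}$-graded by $\deg a_i=0$ and $\deg x_j=w_j$ with integers $w_1,\dots,w_k>0$. Let $I\subseteq P$ be a homogeneous ideal with $I\cap A=\{0\}$, so that $R=P/I$ is a positive $A$-algebra, and let $\Theta:\operatorname{Spec}(R)\to\mathbb{A}^m_K=\operatorname{Spec}(A)$ be the canonical morphism induced by $A\to P\to R$. For $\Gamma=(\gamma_1,\dots,\gamma_m)\in K^m$, let $\mathfrak{M}_{\Gamma_0}=\langle a_1-\gamma_1,\dots,a_m-\gamma_m,x_1,\dots,x_k\rangle\subseteq P$ be the maximal ideal of the point $\Gamma_0=(\gamma_1,\dots,\gamma_m,0,\dots,0)$, and let $R_{\Gamma_0}=(P/I)_{\mathfrak{M}_{\Gamma_0}/I}$ be the local ring of $\operatorname{Spec}(R)$ at this zero section point over $\Gamma$. Let $I_\Gamma\subseteq K[x_1,\dots,x_k]$ be the image of $I$ under the substitution $a_i\mapsto\gamma_i$, so that $K[x_1,\dots,x_k]/I_\Gamma$ is the coordinate ring of the fiber $F_\Gamma=\Theta^{-1}(\Gamma)$,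 and let $R_{F_\Gamma}=(K[x_1,\dots,x_k]/I_\Gamma)_{\langle x_1,\dots,x_k\rangle/I_\Gamma}$ be the local ring of $F_\Gamma$ at its vertex (the origin). For a Noetherian local ring $(S,\mathfrak{m})$ let $\operatorname{ecod}(S)=\dim_{S/\mathfrak{m}}(\mathfrak{m}/\mathfrak{m}^2)-\dim(S)$ be its embedding codimension (which is positive if and only if $S$ is not a regular local ring), and define $$\operatorname{Sing}_0(\Theta)=\{\Gamma\in K^m \mid \operatorname{ecod}(R_{\Gamma_0})>0\},\qquad \operatorname{Sing}_v(\Theta)=\{\Gamma\in K^m \mid \operatorname{ecod}(R_{F_\Gamma})>0\}.$$ Then $\operatorname{Sing}_v(\Theta)\subseteq\operatorname{Sing}_0(\Theta)$. That is, if the vertex of the fiber $F_\Gamma$ is a singular point of $F_\Gamma$, then the zero section point $\Gamma_0$ over $\Gamma$ is a singular point of $\operatorname{Spec}(R)$. -/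

import Mathlib

set_option maxSynthPendingDepth 3

/-- The base ring `A = K[a₁, …, a_m]`. -/
abbrev BaseRing (K : Type*) [Field K] (m : ℕ) := MvPolynomial (Fin m) K

/-- The polynomial ring `P = A[x₁, …, x_k]` over `A = K[a₁, …, a_m]`. -/
abbrev TotalRing (K : Type*) [Field K] (m k : ℕ) := MvPolynomial (Fin k) (BaseRing K m)

section Grading

attribute [local instance] MvPolynomial.weightedGradedAlgebra

/-- The datum of a positive `A`-algebra `R = P/I`: positive integer weights `w₁, …, w_k` of
`x₁, …, x_k` (with `A` in degree zero) and an ideal `I` of `P` that is homogeneous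
for the grading of `P` by these weights and satisfies `I ∩ A = {0}`. -/
structure PositiveAlgebra (K : Type*) [Field K] (m k : ℕ) where
  /-- the weights of the indeterminates -/
  W : Fin k → ℤ
  W_pos : ∀ j, 0 < W j
  /-- the defining ideal -/
  I : Ideal (TotalRing K m k)
  homogeneous :
    I.IsHomogeneous (MvPolynomial.weightedHomogeneousSubmodule (BaseRing K m) W)
  inter_base : I.comap (MvPolynomial.C : BaseRing K m →+* TotalRing K m k) = ⊥

/-- The defining ideal of a positive `A`-algebra is contained in `⟨x₁, …, x_k⟩`, i.e. its
elements have vanishing constant coefficient. -/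
theorem PositiveAlgebra.constantCoeff_eq_zero {K : Type*} [Field K] {m k : ℕ}
    (R : PositiveAlgebra K m k) {f : TotalRing K m k} (hf : f ∈ R.I) :
    MvPolynomial.constantCoeff f = 0 := by
  have h := R.homogeneous 0 hf
  rw [← DirectSum.Decomposition.decompose'_eq,
    MvPolynomial.weightedDecomposition.decompose'_apply] at h
  have hC : MvPolynomial.weightedHomogeneousComponent R.W 0 f
      = MvPolynomial.C (MvPolynomial.constantCoeff f) := by
    classical
    ext1 d
    rw [MvPolynomial.coeff_weightedHomogeneousComponent, MvPolynomial.coeff_C]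
    by_cases hd : d = 0
    · subst hd
      simp [MvPolynomial.constantCoeff_eq]
    · have hne : Finsupp.weight R.W d ≠ 0 := by
        obtain ⟨j, hj⟩ := Finsupp.ne_iff.mp hd
        rw [Finsupp.weight_apply]
        apply ne_of_gt
        refine Finset.sum_pos' (fun i _ => ?_) ⟨j, Finsupp.mem_support_iff.mpr hj, ?_⟩
        · exact nsmul_nonneg (R.W_pos i).le _
        · exact nsmul_pos (R.W_pos j) hj
      rw [if_neg hne, if_neg (Ne.symm hd)]
  rw [hC] at h
  have h2 : MvPolynomial.constantCoeff f ∈ R.I.comap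
      (MvPolynomial.C : BaseRing K m →+* TotalRing K m k) := h
  rw [R.inter_base] at h2
  exact h2

end Grading

section EmbeddingCodimension

open IsLocalRing

/-- The embedding dimension of a local ring: the dimension of its cotangent space `𝔪/𝔪²` over
its residue field. -/
noncomputable def edim (S : Type*) [CommRing S] [IsLocalRing S] : ℕ :=
  Module.finrank (ResidueField S) (CotangentSpace S)

/-- The embedding codimension `edim S - dim S` of a Noetherian local ring `S`. The Krull dimension
of such a ring is a natural number, so the conversions below lose nothing
(see `edim_eq_dim_add_ecod`). -/
noncomputable def ecod (S : Type*) [CommRing S] [IsLocalRing S] [IsNoetherianRing S] : ℤ :=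
  (edim S : ℤ) - (((ringKrullDim S).unbotD 0).toNat : ℤ)

theorem ringKrullDim_eq_natCast (S : Type*) [CommRing S] [IsLocalRing S] [IsNoetherianRing S] :
    ringKrullDim S = ((((ringKrullDim S).unbotD 0).toNat : ℕ) : WithBot ℕ∞) := by
  have hle := ringKrullDim_le_spanFinrank_maximalIdeal S
  have h0 : (0 : WithBot ℕ∞) ≤ ringKrullDim S := ringKrullDim_nonneg_of_nontrivial
  generalize ringKrullDim S = d at hle h0
  induction d with
  | bot => simp at h0
  | coe d =>
    induction d with
    | top => exact absurd hle (by
        intro h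
        have := WithBot.coe_le_coe.mp h
        simp at this)
    | coe d => rfl

theorem edim_eq_dim_add_ecod (S : Type*) [CommRing S] [IsLocalRing S] [IsNoetherianRing S] :
    ∃ d : ℕ, ringKrullDim S = d ∧ (edim S : ℤ) = d + ecod S :=
  ⟨_, ringKrullDim_eq_natCast S, by unfold ecod; ring⟩

/-- A Noetherian local ring has positive embedding codimension iff it is not regular. -/
theorem ecod_pos_iff (S : Type*) [CommRing S] [IsLocalRing S] [IsNoetherianRing S] :
    0 < ecod S ↔ ¬ IsRegularLocalRing S := by
  have hle := ringKrullDim_le_spanFinrank_maximalIdeal S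
  rw [spanFinrank_maximalIdeal_eq_finrank_cotangentSpace] at hle
  rw [IsRegularLocalRing.iff_finrank_cotangentSpace]
  change ringKrullDim S ≤ (edim S : WithBot ℕ∞) at hle
  change _ ↔ ¬ (edim S : WithBot ℕ∞) = ringKrullDim S
  obtain ⟨d, hd, he⟩ := edim_eq_dim_add_ecod S
  rw [hd] at hle ⊢
  norm_cast at hle ⊢
  omega

end EmbeddingCodimension

namespace PositiveAlgebra

variable {K : Type*} [Field K] {m k : ℕ}

/-- The ring `R = P/I`. The canonical morphism `Θ : Spec R → Spec A` is the one given by the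
`A`-algebra structure of this ring. -/
abbrev CoordRing (R : PositiveAlgebra K m k) := TotalRing K m k ⧸ R.I

/-- The maximal ideal `𝔐_{Γ₀}` of `P` that corresponds to the zero point
`Γ₀ = (γ₁, …, γ_m, 0, …, 0)` over `Γ`: the polynomials vanishing at `Γ₀`. -/
noncomputable def zeroPointIdeal (k : ℕ) (Γ : Fin m → K) : Ideal (TotalRing K m k) :=
  RingHom.ker (MvPolynomial.eval₂Hom (MvPolynomial.eval Γ) (0 : Fin k → K))

/-- The ideal `𝔐_{Γ₀}/I` of `R = P/I`. -/
noncomputable def zeroPointIdealQuot (R : PositiveAlgebra K m k) (Γ : Fin m → K) :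
    Ideal R.CoordRing :=
  (zeroPointIdeal k Γ).map (Ideal.Quotient.mk R.I)

theorem eval_zeroPoint (Γ : Fin m → K) (f : TotalRing K m k) :
    MvPolynomial.eval₂Hom (MvPolynomial.eval Γ) (0 : Fin k → K) f
      = MvPolynomial.eval Γ (MvPolynomial.constantCoeff f) := by
  rw [MvPolynomial.eval₂Hom_zero_apply]

theorem I_le_zeroPointIdeal (R : PositiveAlgebra K m k) (Γ : Fin m → K) :
    R.I ≤ zeroPointIdeal k Γ := by
  intro f hf
  rw [zeroPointIdeal, RingHom.mem_ker, eval_zeroPoint, R.constantCoeff_eq_zero hf, map_zero]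

instance zeroPointIdealQuot_isPrime (R : PositiveAlgebra K m k) (Γ : Fin m → K) :
    (R.zeroPointIdealQuot Γ).IsPrime := by
  have : (zeroPointIdeal k Γ).IsPrime := RingHom.ker_isPrime _
  apply Ideal.map_isPrime_of_surjective Ideal.Quotient.mk_surjective
  rw [Ideal.mk_ker]
  exact R.I_le_zeroPointIdeal Γ

/-- The local ring `R_{Γ₀}` of `Spec R` at the zero point over `Γ`. -/
abbrev ZeroPointLocalRing (R : PositiveAlgebra K m k) (Γ : Fin m → K) :=
  Localization.AtPrime (R := R.CoordRing) (R.zeroPointIdealQuot Γ)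

/-- The fiber ideal `I_Γ` of `K[X] = K[x₁, …, x_k]`: the image of `I` under the epimorphism
`P → K[X]` that substitutes `γᵢ` for `aᵢ`. -/
noncomputable def fiberIdeal (R : PositiveAlgebra K m k) (Γ : Fin m → K) :
    Ideal (MvPolynomial (Fin k) K) :=
  R.I.map (MvPolynomial.map (MvPolynomial.eval Γ))

/-- The coordinate ring `K[X]/I_Γ` of the fiber `F_Γ` of `Θ` over `Γ`. -/
abbrev FiberRing (R : PositiveAlgebra K m k) (Γ : Fin m → K) :=
  MvPolynomial (Fin k) K ⧸ R.fiberIdeal Γ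

/-- The ideal `⟨x₁, …, x_k⟩/I_Γ` of `K[X]/I_Γ`, i.e. the vertex of the fiber `F_Γ`. -/
noncomputable def vertexIdeal (R : PositiveAlgebra K m k) (Γ : Fin m → K) :
    Ideal (R.FiberRing Γ) :=
  (Ideal.span (Set.range MvPolynomial.X)).map (Ideal.Quotient.mk (R.fiberIdeal Γ))

instance vertexIdeal_isPrime (R : PositiveAlgebra K m k) (Γ : Fin m → K) :
    (R.vertexIdeal Γ).IsPrime := by
  have hker : Ideal.span (Set.range (MvPolynomial.X : Fin k → MvPolynomial (Fin k) K))
      = RingHom.ker (MvPolynomial.constantCoeff : MvPolynomial (Fin k) K →+* K) := by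
    ext f
    rw [← Set.image_univ, MvPolynomial.mem_ideal_span_X_image, RingHom.mem_ker,
      MvPolynomial.constantCoeff_eq]
    constructor
    · intro h
      by_contra h0
      obtain ⟨i, -, hi⟩ := h 0 (MvPolynomial.mem_support_iff.mpr h0)
      exact hi rfl
    · intro h0 d hd
      have hd0 : d ≠ 0 := by
        rintro rfl
        exact MvPolynomial.mem_support_iff.mp hd h0
      obtain ⟨i, hi⟩ := Finsupp.ne_iff.mp hd0
      exact ⟨i, Set.mem_univ i, hi⟩
  rw [vertexIdeal, hker]
  have : (RingHom.ker (MvPolynomial.constantCoeff :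
      MvPolynomial (Fin k) K →+* K)).IsPrime := RingHom.ker_isPrime _
  apply Ideal.map_isPrime_of_surjective Ideal.Quotient.mk_surjective
  rw [Ideal.mk_ker, fiberIdeal, Ideal.map_le_iff_le_comap]
  intro f hf
  rw [Ideal.mem_comap, RingHom.mem_ker, MvPolynomial.constantCoeff_map,
    R.constantCoeff_eq_zero hf, map_zero]

/-- The local ring `R_{F_Γ}` of the fiber `F_Γ` at its vertex. -/
abbrev FiberLocalRing (R : PositiveAlgebra K m k) (Γ : Fin m → K) :=
  Localization.AtPrime (R.vertexIdeal Γ)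

/-- The set `Sing₀(Θ)` of zero section singularities. -/
def singZero (R : PositiveAlgebra K m k) : Set (Fin m → K) :=
  {Γ | 0 < ecod (R.ZeroPointLocalRing Γ)}

/-- The set `Sing_v(Θ)` of fiber vertex singularities. -/
def singVertex (R : PositiveAlgebra K m k) : Set (Fin m → K) :=
  {Γ | 0 < ecod (R.FiberLocalRing Γ)}

end PositiveAlgebra

/-! ### Quotients of a regular local ring by part of a regular system of parameters. -/

section RegularQuotient

open IsLocalRing

/-! By contraposition, regularity descends from the local ring of `Spec R` at the zero point to that
of the fiber at its vertex. The latter is the quotient of the former by the `m` elements `aᵢ - γᵢ`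
(`ker_localToFiber`). Dividing a regular local ring by elements of its maximal ideal preserves
regularity when their classes in the cotangent space are independent
(`IsRegularLocalRing.of_surjective_of_ker_eq_span`).

Independence is where positivity enters. Since `I` has no constant terms, the constant coefficient
retracts `R` onto `A`, so each coordinate direction of the base at `Γ` lifts to a tangent vector of
`Spec R` along the zero section, that is, to a map into the dual numbers. These vectors are dual to
the `aᵢ - γᵢ`. -/

/-- The maximal ideal of a Noetherian local ring `S` is generated by any finite family whose
classes in the cotangent space are linearly independent, together with `edim S - m` further
elements. -/
theorem exists_maximalIdeal_eq_span_sup_span {S : Type*} [CommRing S] [IsLocalRing S]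
    [IsNoetherianRing S] {m : ℕ} (t : Fin m → maximalIdeal S)
    (ht : LinearIndependent (ResidueField S)
      (fun i => ((maximalIdeal S).toCotangent (t i) : CotangentSpace S))) :
    ∃ (q : ℕ) (y : Fin q → S), m + q = Module.finrank (ResidueField S) (CotangentSpace S) ∧
      maximalIdeal S = Ideal.span (Set.range fun i => (t i : S)) ⊔ Ideal.span (Set.range y) := by
  let v : Fin m → CotangentSpace S := fun i => (maximalIdeal S).toCotangent (t i)
  obtain ⟨Q, hQ⟩ := (Submodule.span (ResidueField S) (Set.range v)).exists_isCompl
  let b := Module.finBasis (ResidueField S) Q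
  choose y hy using fun j => (maximalIdeal S).toCotangent_surjective (b j : CotangentSpace S)
  refine ⟨_, fun j => (y j : S), ?_, ?_⟩
  · rw [← Submodule.finrank_add_eq_of_isCompl hQ, finrank_span_eq_card ht, Fintype.card_fin]
  -- Nakayama: generators of the cotangent space lift to generators of the maximal ideal.
  · have hspan : Submodule.span S (Set.range t ∪ Set.range y) = ⊤ := by
      rw [← CotangentSpace.span_image_eq_top_iff, Set.image_union, Submodule.span_union,
        ← Set.range_comp, ← Set.range_comp, ← hQ.sup_eq_top]
      congr 1
      have hfun : (maximalIdeal S).toCotangent ∘ y = fun j => (Q.subtype (b j)) := funext hy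
      rw [hfun]
      change Submodule.span _ (Set.range (Q.subtype ∘ b)) = Q
      rw [Set.range_comp, ← Submodule.map_span, b.span_eq, Submodule.map_subtype_top]
    have := congrArg (Submodule.map (maximalIdeal S).subtype) hspan
    rw [Submodule.map_subtype_top, Submodule.map_span, Set.image_union, ← Set.range_comp,
      ← Set.range_comp, Submodule.span_union] at this
    exact this.symm

/-- The quotient of a regular local ring by elements of its maximal ideal that are linearly
independent in the cotangent space is regular. -/
theorem IsRegularLocalRing.of_surjective_of_ker_eq_span {S F : Type*} [CommRing S] [CommRing F]
    [IsRegularLocalRing S] [IsLocalRing F] [IsNoetherianRing F] {m : ℕ} (φ : S →+* F)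
    (hφ : Function.Surjective φ) (t : Fin m → maximalIdeal S)
    (ht : LinearIndependent (ResidueField S)
      (fun i => ((maximalIdeal S).toCotangent (t i) : CotangentSpace S)))
    (hker : RingHom.ker φ = Ideal.span (Set.range fun i => (t i : S))) :
    IsRegularLocalRing F := by
  obtain ⟨q, y, hq, hy⟩ := exists_maximalIdeal_eq_span_sup_span t ht
  have hS := (IsRegularLocalRing.iff_finrank_cotangentSpace S).mp ‹_›
  have hgen : maximalIdeal F = Ideal.span (Set.range (φ ∘ y)) := by
    have : IsLocalHom φ := IsLocalHom.of_surjective φ hφ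
    have h1 : (maximalIdeal S).map φ = maximalIdeal F := by
      have h0 : (maximalIdeal F).comap φ = maximalIdeal S :=
        ((IsLocalRing.local_hom_TFAE φ).out 0 4).mp this
      rw [← h0]
      exact Ideal.map_comap_of_surjective φ hφ _
    rw [← h1, hy, Ideal.map_sup, ← hker, (Ideal.map_eq_bot_iff_le_ker φ).mpr le_rfl, bot_sup_eq,
      Ideal.map_span, Set.range_comp]
  apply IsRegularLocalRing.of_spanFinrank_maximalIdeal_le
  have hle : (maximalIdeal F).spanFinrank ≤ q := by
    rw [hgen]
    refine (Submodule.spanFinrank_span_le_ncard_of_finite (Set.finite_range _)).trans ?_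
    rw [← Set.image_univ]
    exact (Set.ncard_image_le Set.finite_univ).trans (by simp)
  -- Dividing by `m` elements of the maximal ideal lowers the dimension by at most `m`.
  have hdim : ringKrullDim S ≤ ringKrullDim F + m := by
    have hmem : Ideal.span (Set.range fun i => (t i : S)) ≤ Ring.jacobson S := by
      rw [IsLocalRing.ringJacobson_eq_maximalIdeal, Ideal.span_le]
      rintro _ ⟨i, rfl⟩
      exact (t i).2
    refine (ringKrullDim_le_ringKrullDim_quotient_add_spanFinrank _ hmem).trans ?_
    rw [← hker, ringKrullDim_eq_of_ringEquiv (RingHom.quotientKerEquivOfSurjective hφ), hker]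
    gcongr
    refine (Submodule.spanFinrank_span_le_ncard_of_finite (Set.finite_range _)).trans ?_
    rw [← Set.image_univ]
    exact (Set.ncard_image_le Set.finite_univ).trans (by simp)
  -- Regularity of `S` turns `hdim` into `m + q ≤ dim F + m`. Dimensions are rewritten as naturals
  -- so that `m` cancels, and `q` bounds the number of generators needed in `F`.
  rw [← hS, ← hq, ringKrullDim_eq_natCast F] at hdim
  rw [ringKrullDim_eq_natCast F]
  norm_cast at hdim ⊢
  omega

open scoped DualNumber in
/-- Elements of the maximal ideal that are dual to a family of tangent vectors are linearly
independent in the cotangent space. -/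
theorem linearIndependent_toCotangent_of_dualNumber {S K ι : Type*} [CommRing S] [IsLocalRing S]
    [Field K] [Fintype ι] [DecidableEq ι] (t : ι → maximalIdeal S) (ψ : ι → S →+* K[ε])
    (hψ : ∀ j, ∀ x ∈ maximalIdeal S, (ψ j x).fst = 0)
    (ht : ∀ i j, ψ j (t i) = if i = j then DualNumber.eps else 0) :
    LinearIndependent (ResidueField S)
      (fun i => ((maximalIdeal S).toCotangent (t i) : CotangentSpace S)) := by
  rw [Fintype.linearIndependent_iff]
  intro g hg j
  choose c hc using fun i => IsLocalRing.residue_surjective (g i)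
  have hmem : ∑ i, c i * (t i : S) ∈ maximalIdeal S ^ 2 := by
    have h : (maximalIdeal S).toCotangent (∑ i, c i • t i) = 0 := by
      rw [map_sum, ← hg]
      refine Finset.sum_congr rfl fun i _ => ?_
      rw [map_smul, ← hc i]
      rfl
    rw [Ideal.toCotangent_eq_zero] at h
    simpa using h
  -- The maximal ideal lands in multiples of `ε`, and `ε² = 0`.
  have hsq : maximalIdeal S ^ 2 ≤ RingHom.ker (ψ j) := by
    rw [pow_two, Ideal.mul_le]
    intro x hx y hy
    rw [RingHom.mem_ker, map_mul]
    ext <;> simp [hψ j x hx, hψ j y hy]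
  have h0 := congrArg TrivSqZeroExt.snd (RingHom.mem_ker.mp (hsq hmem))
  simp only [map_sum, map_mul, ht, mul_ite, mul_zero, Finset.sum_ite_eq', Finset.mem_univ,
    if_true] at h0
  rw [DualNumber.snd_mul, DualNumber.snd_eps, DualNumber.fst_eps, mul_one, mul_zero, add_zero,
    TrivSqZeroExt.snd_zero] at h0
  -- `h0` now says that `ψ j (c j)` has zero first component, so `c j` cannot be a unit.
  rw [← hc j, IsLocalRing.residue_eq_zero_iff]
  intro hu
  have := TrivSqZeroExt.isUnit_iff_isUnit_fst.mp (hu.map (ψ j))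
  rw [h0] at this
  exact not_isUnit_zero this

end RegularQuotient

/-! ### The local ring of the fiber as a quotient of the local ring at the zero point. -/

namespace PositiveAlgebra

variable {K : Type*} [Field K] {m k : ℕ}

open IsLocalRing MvPolynomial

/-- The epimorphism from `R` to the coordinate ring of the fiber over `Γ`. -/
noncomputable def toFiber (R : PositiveAlgebra K m k) (Γ : Fin m → K) :
    R.CoordRing →+* R.FiberRing Γ :=
  Ideal.quotientMap (R.fiberIdeal Γ) (MvPolynomial.map (MvPolynomial.eval Γ)) Ideal.le_comap_map

theorem toFiber_mk (R : PositiveAlgebra K m k) (Γ : Fin m → K) (f : TotalRing K m k) :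
    R.toFiber Γ (Ideal.Quotient.mk R.I f) =
      Ideal.Quotient.mk (R.fiberIdeal Γ) (MvPolynomial.map (MvPolynomial.eval Γ) f) :=
  rfl

theorem map_eval_surjective (Γ : Fin m → K) : Function.Surjective
    (MvPolynomial.map (MvPolynomial.eval Γ) : TotalRing K m k →+* MvPolynomial (Fin k) K) :=
  MvPolynomial.map_surjective _ fun c => ⟨C c, eval_C c⟩

theorem toFiber_surjective (R : PositiveAlgebra K m k) (Γ : Fin m → K) :
    Function.Surjective (R.toFiber Γ) :=
  Ideal.quotientMap_surjective (map_eval_surjective Γ)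

theorem ker_eval_eq_span (Γ : Fin m → K) :
    RingHom.ker (MvPolynomial.eval Γ) = Ideal.span (Set.range fun i => X i - C (Γ i)) := by
  set J := Ideal.span (Set.range fun i => (X i - C (Γ i) : MvPolynomial (Fin m) K))
  apply le_antisymm
  · intro f hf
    -- Modulo `J` every polynomial equals its value at `Γ`.
    have h : (Ideal.Quotient.mk J) = (((Ideal.Quotient.mk J).comp C).comp (eval Γ)) := by
      refine MvPolynomial.ringHom_ext (fun c => by simp) fun i => ?_
      rw [RingHom.comp_apply, RingHom.comp_apply, eval_X, Ideal.Quotient.mk_eq_mk_iff_sub_mem]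
      exact Ideal.subset_span ⟨i, rfl⟩
    rw [← Ideal.Quotient.eq_zero_iff_mem, h, RingHom.comp_apply, RingHom.mem_ker.mp hf, map_zero]
  · rw [Ideal.span_le]
    rintro _ ⟨i, rfl⟩
    simp [RingHom.mem_ker]

/-- The preimage of `I_Γ` in `P` is `I` plus the kernel of the substitution, and `I` vanishes in
`R`. -/
theorem ker_toFiber (R : PositiveAlgebra K m k) (Γ : Fin m → K) :
    RingHom.ker (R.toFiber Γ) =
      Ideal.span (Set.range fun i => Ideal.Quotient.mk R.I (C (X i - C (Γ i)))) := by
  have hI : RingHom.ker (R.toFiber Γ) =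
      ((R.fiberIdeal Γ).comap (MvPolynomial.map (eval Γ))).map (Ideal.Quotient.mk R.I) := by
    ext x
    obtain ⟨f, rfl⟩ := Ideal.Quotient.mk_surjective x
    rw [← Ideal.mem_comap, ← Ideal.mem_comap, Ideal.comap_map_of_surjective' _
      Ideal.Quotient.mk_surjective, Ideal.mk_ker, sup_eq_left.mpr Ideal.le_comap_map,
      Ideal.mem_comap, RingHom.mem_ker, toFiber_mk,
      Ideal.Quotient.eq_zero_iff_mem, Ideal.mem_comap]
  rw [hI, fiberIdeal, Ideal.comap_map_of_surjective' _ (map_eval_surjective Γ), Ideal.map_sup,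
    Ideal.map_quotient_self, bot_sup_eq, MvPolynomial.ker_map, ker_eval_eq_span, Ideal.map_span,
    Ideal.map_span, ← Set.range_comp, ← Set.range_comp]
  rfl

theorem mem_zeroPointIdealQuot_iff (R : PositiveAlgebra K m k) (Γ : Fin m → K)
    (f : TotalRing K m k) :
    Ideal.Quotient.mk R.I f ∈ R.zeroPointIdealQuot Γ ↔ eval Γ (constantCoeff f) = 0 := by
  rw [zeroPointIdealQuot, ← Ideal.mem_comap, Ideal.comap_map_of_surjective' _
    Ideal.Quotient.mk_surjective, Ideal.mk_ker, sup_eq_left.mpr (R.I_le_zeroPointIdeal Γ),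
    zeroPointIdeal, RingHom.mem_ker, eval_zeroPoint]

theorem fiberIdeal_le_ker_constantCoeff (R : PositiveAlgebra K m k) (Γ : Fin m → K) :
    R.fiberIdeal Γ ≤ RingHom.ker constantCoeff := by
  rw [fiberIdeal, Ideal.map_le_iff_le_comap]
  intro f hf
  rw [Ideal.mem_comap, RingHom.mem_ker, constantCoeff_map, R.constantCoeff_eq_zero hf, map_zero]

theorem span_range_X_eq_ker_constantCoeff :
    Ideal.span (Set.range (X : Fin k → MvPolynomial (Fin k) K)) =
      RingHom.ker (constantCoeff : MvPolynomial (Fin k) K →+* K) := by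
  rw [← MvPolynomial.eval_zero, ker_eval_eq_span]
  simp

theorem mem_vertexIdeal_iff (R : PositiveAlgebra K m k) (Γ : Fin m → K)
    (f : MvPolynomial (Fin k) K) :
    Ideal.Quotient.mk (R.fiberIdeal Γ) f ∈ R.vertexIdeal Γ ↔ constantCoeff f = 0 := by
  rw [vertexIdeal, span_range_X_eq_ker_constantCoeff, ← Ideal.mem_comap,
    Ideal.comap_map_of_surjective' _ Ideal.Quotient.mk_surjective, Ideal.mk_ker,
    sup_eq_left.mpr (R.fiberIdeal_le_ker_constantCoeff Γ), RingHom.mem_ker]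

theorem comap_toFiber_vertexIdeal (R : PositiveAlgebra K m k) (Γ : Fin m → K) :
    (R.vertexIdeal Γ).comap (R.toFiber Γ) = R.zeroPointIdealQuot Γ := by
  ext x
  obtain ⟨f, rfl⟩ := Ideal.Quotient.mk_surjective x
  rw [Ideal.mem_comap, mem_zeroPointIdealQuot_iff, toFiber_mk,
    mem_vertexIdeal_iff, constantCoeff_map]

/-- The epimorphism from the local ring at the zero point over `Γ` to the local ring of the
fiber at its vertex. -/
noncomputable def localToFiber (R : PositiveAlgebra K m k) (Γ : Fin m → K) :
    R.ZeroPointLocalRing Γ →+* R.FiberLocalRing Γ :=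
  Localization.localRingHom _ _ (R.toFiber Γ) (R.comap_toFiber_vertexIdeal Γ).symm

theorem map_toFiber_primeCompl (R : PositiveAlgebra K m k) (Γ : Fin m → K) :
    Submonoid.map (R.toFiber Γ) (R.zeroPointIdealQuot Γ).primeCompl =
      (R.vertexIdeal Γ).primeCompl := by
  have h : (R.zeroPointIdealQuot Γ).primeCompl =
      (R.vertexIdeal Γ).primeCompl.comap (R.toFiber Γ) := by
    ext x
    rw [Submonoid.mem_comap, Ideal.mem_primeCompl_iff, Ideal.mem_primeCompl_iff,
      ← R.comap_toFiber_vertexIdeal Γ, Ideal.mem_comap]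
  rw [h]
  exact Submonoid.map_comap_eq_of_surjective (f := (R.toFiber Γ).toMonoidHom)
    (R.toFiber_surjective Γ) _

theorem localToFiber_surjective (R : PositiveAlgebra K m k) (Γ : Fin m → K) :
    Function.Surjective (R.localToFiber Γ) := by
  intro z
  obtain ⟨x, s, rfl⟩ := IsLocalization.exists_mk'_eq (R.vertexIdeal Γ).primeCompl z
  obtain ⟨x, rfl⟩ := R.toFiber_surjective Γ x
  obtain ⟨s, hs⟩ := s
  rw [← R.map_toFiber_primeCompl Γ] at hs
  obtain ⟨s, hs', rfl⟩ := hs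
  exact ⟨IsLocalization.mk' _ x ⟨s, hs'⟩, Localization.localRingHom_mk' ..⟩

/-- Localization commutes with kernels, so the generators found in `R` still suffice. -/
theorem ker_localToFiber (R : PositiveAlgebra K m k) (Γ : Fin m → K) :
    RingHom.ker (R.localToFiber Γ) = Ideal.span (Set.range fun i =>
      algebraMap R.CoordRing (R.ZeroPointLocalRing Γ)
        (Ideal.Quotient.mk R.I (C (X i - C (Γ i))))) := by
  have h := IsLocalization.ker_map (S := R.ZeroPointLocalRing Γ) (R.FiberLocalRing Γ)
    (R.toFiber Γ) (R.map_toFiber_primeCompl Γ)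
  rw [ker_toFiber, Ideal.map_span, ← Set.range_comp] at h
  exact h

/-! ### Tangent vectors along the zero section. -/

open scoped DualNumber

open DualNumber

/-- The tangent vector of `Spec R` at the zero point over `Γ` in the direction of `aⱼ`. -/
noncomputable def toDual (R : PositiveAlgebra K m k) (Γ : Fin m → K) (j : Fin m) :
    R.CoordRing →+* K[ε] :=
  Ideal.Quotient.lift R.I
    ((eval₂Hom (algebraMap K K[ε]) fun i => algebraMap K K[ε] (Γ i) + if i = j then ε else 0).comp
      constantCoeff)
    fun f hf => by rw [RingHom.comp_apply, R.constantCoeff_eq_zero hf, map_zero]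

theorem fst_toDual (R : PositiveAlgebra K m k) (Γ : Fin m → K) (j : Fin m)
    (f : TotalRing K m k) :
    (R.toDual Γ j (Ideal.Quotient.mk R.I f)).fst = eval Γ (constantCoeff f) := by
  let e := eval₂Hom (algebraMap K K[ε]) fun i => algebraMap K K[ε] (Γ i) + if i = j then ε else 0
  have h : (TrivSqZeroExt.fstHom K K K).toRingHom.comp e = eval Γ := by
    refine MvPolynomial.ringHom_ext (fun c => ?_) fun i => ?_
    · simp [e, TrivSqZeroExt.algebraMap_eq_inl]
    · by_cases hij : i = j <;> simp [e, hij, TrivSqZeroExt.algebraMap_eq_inl]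
  exact RingHom.congr_fun h (constantCoeff f)

theorem toDual_C_X_sub_C (R : PositiveAlgebra K m k) (Γ : Fin m → K) (i j : Fin m) :
    R.toDual Γ j (Ideal.Quotient.mk R.I (C (X i - C (Γ i)))) = if i = j then ε else 0 := by
  rw [toDual, Ideal.Quotient.lift_mk, RingHom.comp_apply, constantCoeff_C, map_sub, eval₂Hom_X',
    eval₂Hom_C, add_sub_cancel_left]

/-- The tangent vector `toDual`, extended to the local ring. -/
noncomputable def localToDual (R : PositiveAlgebra K m k) (Γ : Fin m → K) (j : Fin m) :
    R.ZeroPointLocalRing Γ →+* K[ε] :=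
  IsLocalization.lift (M := (R.zeroPointIdealQuot Γ).primeCompl) (g := R.toDual Γ j) <| by
    rintro ⟨x, hx⟩
    obtain ⟨f, rfl⟩ := Ideal.Quotient.mk_surjective x
    rw [Ideal.mem_primeCompl_iff, mem_zeroPointIdealQuot_iff] at hx
    rw [TrivSqZeroExt.isUnit_iff_isUnit_fst, fst_toDual]
    exact isUnit_iff_ne_zero.mpr hx

theorem fst_localToDual_eq_zero (R : PositiveAlgebra K m k) (Γ : Fin m → K) (j : Fin m)
    {x : R.ZeroPointLocalRing Γ} (hx : x ∈ maximalIdeal (R.ZeroPointLocalRing Γ)) :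
    (R.localToDual Γ j x).fst = 0 := by
  have h : maximalIdeal (R.ZeroPointLocalRing Γ) ≤ RingHom.ker
      ((TrivSqZeroExt.fstHom K K K).toRingHom.comp (R.localToDual Γ j)) := by
    rw [← Localization.AtPrime.map_eq_maximalIdeal, Ideal.map_le_iff_le_comap]
    intro y hy
    obtain ⟨f, rfl⟩ := Ideal.Quotient.mk_surjective y
    rw [mem_zeroPointIdealQuot_iff, ← R.fst_toDual Γ j] at hy
    change (R.localToDual Γ j (algebraMap _ _ _)).fst = 0
    rw [localToDual, IsLocalization.lift_eq, hy]
  exact h hx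

/-- The element `aᵢ - γᵢ` of the maximal ideal of the local ring at the zero point over `Γ`. -/
noncomputable def baseParameter (R : PositiveAlgebra K m k) (Γ : Fin m → K) (i : Fin m) :
    maximalIdeal (R.ZeroPointLocalRing Γ) :=
  ⟨algebraMap R.CoordRing _ (Ideal.Quotient.mk R.I (C (X i - C (Γ i)))), by
    rw [IsLocalization.AtPrime.to_map_mem_maximal_iff _ (R.zeroPointIdealQuot Γ),
      mem_zeroPointIdealQuot_iff]
    simp⟩

theorem linearIndependent_baseParameter (R : PositiveAlgebra K m k) (Γ : Fin m → K) :
    LinearIndependent (ResidueField (R.ZeroPointLocalRing Γ)) (fun i =>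
      ((maximalIdeal (R.ZeroPointLocalRing Γ)).toCotangent (R.baseParameter Γ i) :
        CotangentSpace (R.ZeroPointLocalRing Γ))) :=
  linearIndependent_toCotangent_of_dualNumber _ (R.localToDual Γ)
    (fun j _ hx => R.fst_localToDual_eq_zero Γ j hx) fun i j => by
      rw [baseParameter, localToDual, IsLocalization.lift_eq, toDual_C_X_sub_C]

/-- If `Spec R` is regular at the zero point over `Γ`, then the fiber over `Γ` is regular at its
vertex. -/
theorem isRegularLocalRing_fiberLocalRing (R : PositiveAlgebra K m k) (Γ : Fin m → K)
    [IsRegularLocalRing (R.ZeroPointLocalRing Γ)] :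
    IsRegularLocalRing (R.FiberLocalRing Γ) :=
  IsRegularLocalRing.of_surjective_of_ker_eq_span (R.localToFiber Γ) (R.localToFiber_surjective Γ)
    (R.baseParameter Γ) (R.linearIndependent_baseParameter Γ) (R.ker_localToFiber Γ)

end PositiveAlgebra

theorem mainTheorem7 {K : Type*} [Field K] {m k : ℕ} (R : PositiveAlgebra K m k) :
    R.singVertex ⊆ R.singZero := by
  intro Γ hΓ
  rw [PositiveAlgebra.singVertex, Set.mem_ofPred_eq, ecod_pos_iff] at hΓ
  rw [PositiveAlgebra.singZero, Set.mem_ofPred_eq, ecod_pos_iff]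
  exact fun _ => hΓ (R.isRegularLocalRing_fiberLocalRing Γ)
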